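/- Let $P(\alpha,\beta)=\sum_{i=0}^k \alpha^i\beta^{k-i}B_i$ with $B_i\in\mathbb{C}^{n\times n}$ be a homogeneous matrix polynomial of grade $k$ ($B_k=0$ is allowed), and let $(\alpha_0,\beta_0)\neq(0,0)$ be a simple eigenvalue of $P$, i.e. the linear form $\beta_0\alpha-\alpha_0\beta$ divides $\det P(\alpha,\beta)$ exactly once (so $P$ is regular). Let $\omega_0,\dots,\omega_k\ge 0$ be weights such that $\omega_i|\alpha_0|^i|\beta_0|^{k-i}\ne 0$ for at least one $i$. For $(\alpha,\beta)\ne(0,0)$ let $\chi((\alpha_0,\beta_0),(\alpha,\beta))=\sin\arccos\frac{|\alpha_0\overline{\alpha}+\beta_0\overline{\beta}|}{\|(\alpha_0,\beta_0)\|_2\|(\alpha,\beta)\|_2}$ be the chordal distance. The Stewart–Sun condition number of $(\alpha_0,\beta_0)$ is $$\kappa_\theta((\alpha_0,\beta_0),P)=\lim_{\epsilon\to0^+}\sup\Big\{\tfrac1\epsilon\,\chi\big((\alpha_0,\beta_0),(\alpha,\beta)\big)\ :\ \det\Big(\sum_{i=0}^k\alpha^i\beta^{k-i}(B_i+\Delta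 B_i)\Big)=0,\ \ \|\Delta B_i\|_2\le\epsilon\,\omega_i,\ i=0,\dots,k\Big\},$$ where $(\alpha,\beta)$ denotes the eigenvalue of the perturbed polynomial that approaches $(\alpha_0,\beta_0)$ when the perturbation approaches zero, i.e. $(\alpha,\beta)$ is restricted to $\chi((\alpha_0,\beta_0),(\alpha,\beta))<r$ for a fixed sufficiently small $r>0$ (the limit is the same for all sufficiently small $r$). Let $z=[\alpha_0,\beta_0]\in\mathbb{C}^2$, and let $K$ be the differential at $(B_0,\dots,B_k)$ of the local map that sends the coefficients $(A_0,\dots,A_k)$ of a nearby polynomial to its eigenvalue close to $(\alpha_0,\beta_0)$, represented by the unique vector of this line in $z+z^\perp$. The Dedieu–Tisseur condition number of $(\alpha_0,\beta_0)$ is the norm of $K$, $$\kappa_h((\alpha_0,\beta_0),P)=\sup\Big\{\frac{\|K(\omega_0E_0,\dots,\omega_kE_k)\|_2}{\|z\|_2}\ :\ E_i\in\mathbb{C}^{n\times n},\ \sum_{i=0}^k\|E_i\|_F^2\le1\Big\}.$$ Then both condition numbers are well defined (they exist and are uniquely determined), $\kappa_\theta((\alpha_0,\beta_0),P)>0$,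 and $$\frac1{\sqrt{k+1}}\ \le\ \frac{\kappa_h((\alpha_0,\beta_0),P)}{\kappa_\theta((\alpha_0,\beta_0),P)}\ \le\ 1 .$$ -/

import Mathlib

open Filter Topology

/- The space of coefficient tuples is normed through the Frobenius norm of matrices. -/
attribute [local instance] Matrix.frobeniusNormedAddCommGroup Matrix.frobeniusNormedSpace

namespace HomogeneousPEP

noncomputable section

/-- The coefficients `(B_0, …, B_k)` of an `n × n` matrix polynomial of grade `k`
(any of them, including `B_k`, may be zero). -/
abbrev Coeffs (n k : ℕ) : Type := Fin (k + 1) → Matrix (Fin n) (Fin n) ℂ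

/-- The value `P(α, β) = ∑ α^i β^(k-i) B_i` of the homogeneous matrix polynomial. -/
def homEval {n k : ℕ} (B : Coeffs n k) (α β : ℂ) : Matrix (Fin n) (Fin n) ℂ :=
  ∑ i : Fin (k + 1), (α ^ (i : ℕ) * β ^ (k - (i : ℕ))) • B i

/-- The binary form `det P(X₀, X₁)`, as a polynomial in two indeterminates. -/
def detForm {n k : ℕ} (B : Coeffs n k) : MvPolynomial (Fin 2) ℂ :=
  Matrix.det (∑ i : Fin (k + 1),
    ((MvPolynomial.X 0 ^ (i : ℕ) * MvPolynomial.X 1 ^ (k - (i : ℕ)) : MvPolynomial (Fin 2) ℂ) •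
      (B i).map (MvPolynomial.C : ℂ →+* MvPolynomial (Fin 2) ℂ)))

/-- The line through `(α₀, β₀) ≠ (0, 0)` is a simple eigenvalue: its algebraic multiplicity, that
is, the exponent of the linear form `β₀ X₀ - α₀ X₁` in the binary form `det P(X₀, X₁)`, is one.
(If `P` is singular, then the determinant is zero and the multiplicity is infinite.) -/
def IsSimpleEigenvalue {n k : ℕ} (B : Coeffs n k) (α₀ β₀ : ℂ) : Prop :=
  (α₀, β₀) ≠ (0, 0) ∧
    emultiplicity
      (MvPolynomial.C β₀ * MvPolynomial.X 0 - MvPolynomial.C α₀ * MvPolynomial.X 1 :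
        MvPolynomial (Fin 2) ℂ)
      (detForm B) = 1

/-- The spectral norm of a matrix: the operator norm for the Euclidean norm. -/
def specNorm {n : ℕ} (A : Matrix (Fin n) (Fin n) ℂ) : ℝ :=
  ‖Matrix.toEuclideanCLM (n := Fin n) (𝕜 := ℂ) A‖

/-- The angle between the lines spanned by the nonzero vectors `x` and `y` of `ℂ²`. -/
def lineAngle (x y : EuclideanSpace ℂ (Fin 2)) : ℝ :=
  Real.arccos (‖inner ℂ x y‖ / (‖x‖ * ‖y‖))

/-- The chordal distance between the lines spanned by `x` and `y`. -/
def chordalDist (x y : EuclideanSpace ℂ (Fin 2)) : ℝ :=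
  Real.sin (lineAngle x y)

/-- The quotients `χ((α₀, β₀), (α, β)) / ε`, where `(α, β)` runs over the eigenvalues of the
perturbed polynomials `P + ΔP` with `‖ΔB_i‖₂ ≤ ε ω_i` that lie at a chordal distance less than
`r` from `(α₀, β₀)`; here `v` is an eigenvector of `P + ΔP` for `(α, β)`. -/
def chordalQuotients {n k : ℕ} (B : Coeffs n k) (ω : Fin (k + 1) → ℝ) (α₀ β₀ : ℂ)
    (r ε : ℝ) : Set ℝ :=
  {q | ∃ (ΔB : Coeffs n k) (α β : ℂ) (v : Fin n → ℂ),
    (∀ i, specNorm (ΔB i) ≤ ε * ω i) ∧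
    (α, β) ≠ (0, 0) ∧ v ≠ 0 ∧
    Matrix.mulVec (homEval B α β + homEval ΔB α β) v = 0 ∧
    chordalDist !₂[α₀, β₀] !₂[α, β] < r ∧
    q = chordalDist !₂[α₀, β₀] !₂[α, β] / ε}

/-- `κ` is the Stewart-Sun condition number of the eigenvalue `(α₀, β₀)`: the limit, as `ε → 0+`,
of the supremum of `χ((α₀, β₀), (α, β)) / ε`, where `(α, β)` is the eigenvalue of the perturbed
polynomial that approaches `(α₀, β₀)` as the perturbation approaches zero. That eigenvalue is
singled out by a fixed neighbourhood of `(α₀, β₀)`; the limit has to be the same for all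
sufficiently small neighbourhoods. (For `ε > 0` the set of quotients contains `0` when `r > 0` and
`(α₀, β₀)` is an eigenvalue, and it is bounded by `1 / ε`.) -/
def IsStewartSunCondNumber {n k : ℕ} (B : Coeffs n k) (ω : Fin (k + 1) → ℝ) (α₀ β₀ : ℂ)
    (κ : ℝ) : Prop :=
  ∀ᶠ r in 𝓝[>] (0 : ℝ),
    Tendsto (fun ε : ℝ => sSup (chordalQuotients B ω α₀ β₀ r ε)) (𝓝[>] 0) (𝓝 κ)

/-- `K` is the condition operator of the eigenvalue `(α₀, β₀)`: the differential at `B` of the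
locally defined map `S` from coefficient tuples to the projective line that sends `B` to
`(α₀, β₀)` and every tuple `A` near `B` to an eigenvalue of the polynomial with coefficients `A`.
Lines near that of `z = [α₀, β₀]` are given by their unique representative in the affine line
`z + z^⊥`, so that `K` takes its values in `z^⊥`, which is the tangent space at `(α₀, β₀)` of the
projective line. -/
def IsConditionOperator {n k : ℕ} (B : Coeffs n k) (α₀ β₀ : ℂ)
    (K : Coeffs n k →L[ℂ] EuclideanSpace ℂ (Fin 2)) : Prop :=
  ∃ S : Coeffs n k → EuclideanSpace ℂ (Fin 2),
    S B = !₂[α₀, β₀] ∧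
    (∀ᶠ A in 𝓝 B, inner ℂ !₂[α₀, β₀] (S A - !₂[α₀, β₀]) = 0 ∧
      (homEval A (S A 0) (S A 1)).det = 0) ∧
    HasFDerivAt S K B

/-- `κ` is the Dedieu-Tisseur condition number of the eigenvalue `(α₀, β₀)`: the norm of the
condition operator `K`, that is, the supremum of `‖K ΔB‖` over the unit ball of the weighted
Frobenius norm `(∑ ω_i⁻² ‖ΔB_i‖_F²)^(1/2)`, where the tangent space at `(α₀, β₀)` of the projective
line carries the norm `‖·‖₂ / ‖[α₀, β₀]‖₂`. The unit ball is written as the set of the tuples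
`ΔB_i = ω_i E_i` with `∑ ‖E_i‖_F² ≤ 1`, which also covers zero weights (`B_i` is then not
perturbed). -/
def IsDedieuTisseurCondNumber {n k : ℕ} (B : Coeffs n k) (ω : Fin (k + 1) → ℝ) (α₀ β₀ : ℂ)
    (κ : ℝ) : Prop :=
  ∃ K : Coeffs n k →L[ℂ] EuclideanSpace ℂ (Fin 2),
    IsConditionOperator B α₀ β₀ K ∧
    IsLUB {q : ℝ | ∃ E : Coeffs n k, ∑ i, ‖E i‖ ^ 2 ≤ 1 ∧
      q = ‖K (fun i => (ω i : ℂ) • E i)‖ / ‖(!₂[α₀, β₀] : EuclideanSpace ℂ (Fin 2))‖} κ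

end

end HomogeneousPEP

/-! Both condition numbers have closed forms. In the affine chart `z + t z^⊥` of the projective
line, simplicity says that `det P` has a nonzero `t`-derivative `c` at `0`
(`IsSimpleEigenvalue.exists_hasDerivAt`). The implicit function theorem then gives the chart
coordinate of the nearby eigenvalue as a function `φ` of the coefficients. With `N = P(α₀, β₀)`,
Jacobi's formula gives its differential `L H = -c⁻¹ tr (adj N · ∑ α₀^i β₀^(k-i) H i)`.

Jacobi's formula and `c ≠ 0` also force `adj N ≠ 0`, so `adj N` has rank one. A rank-one trace
functional has the same norm `R` against the spectral and the Frobenius norm, attained at a common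
matrix (`exists_dual_norm_vecMulVec`). This is why the two norms can be compared without a factor
depending on `n`.

Put `a i = ω i |α₀|^i |β₀|^(k-i)`. For the Stewart–Sun number the `ΔB i` vary independently and the
chordal distance is `|t|` to first order, so `κθ = R ∑ a i`. For the Dedieu–Tisseur number they
share one Euclidean ball, so `κh = R √(∑ a i ^ 2)`. The claim is the comparison of the `ℓ¹` and `ℓ²`
norms on `k + 1` coordinates. -/

namespace HomogeneousPEP

open Matrix ComplexConjugate

/-! ### Determinants and the binary form `det P`. -/

/-- Jacobi's formula: the derivative of the determinant along a curve of matrices. -/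
theorem hasDerivAt_det {n : ℕ} {M : ℂ → Matrix (Fin n) (Fin n) ℂ} {M' : Matrix (Fin n) (Fin n) ℂ}
    {t : ℂ} (hM : ∀ i j, HasDerivAt (fun s => M s i j) (M' i j) t) :
    HasDerivAt (fun s => (M s).det) (((M t).adjugate * M').trace) t := by
  have key : ((M t).adjugate * M').trace = ∑ σ : Equiv.Perm (Fin n),
      ((Equiv.Perm.sign σ : ℤ) : ℂ) *
        ∑ j, (∏ i ∈ Finset.univ.erase j, M t (σ i) i) • M' (σ j) j := by
    have h1 : ((M t).adjugate * M').trace =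
        ∑ j, ((M t).updateCol j (fun i => M' i j)).det := by
      refine Finset.sum_congr rfl fun j _ => ?_
      rw [← Matrix.cramer_apply, Matrix.cramer_eq_adjugate_mulVec]
      rfl
    rw [h1]
    simp_rw [Matrix.det_apply', Finset.mul_sum]
    rw [Finset.sum_comm]
    refine Finset.sum_congr rfl fun σ _ => Finset.sum_congr rfl fun j _ => ?_
    rw [← Finset.prod_erase_mul _ _ (Finset.mem_univ j), Matrix.updateCol_self, smul_eq_mul]
    congr 2
    refine Finset.prod_congr rfl fun i hi => ?_
    rw [Matrix.updateCol_ne (Finset.ne_of_mem_erase hi)]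
  rw [key]
  simp_rw [Matrix.det_apply']
  refine HasDerivAt.fun_sum fun σ _ => ?_
  exact (HasDerivAt.fun_finsetProd fun i _ => hM (σ i) i).const_mul _

theorem homEval_smul {n k : ℕ} (A : Coeffs n k) (s α β : ℂ) :
    homEval A (s * α) (s * β) = s ^ k • homEval A α β := by
  unfold homEval
  rw [Finset.smul_sum]
  refine Finset.sum_congr rfl fun i _ => ?_
  rw [smul_smul]
  congr 1
  have : s ^ k = s ^ (i : ℕ) * s ^ (k - (i : ℕ)) := by
    rw [← pow_add, Nat.add_sub_cancel' (Nat.lt_succ_iff.mp i.2)]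
  rw [this]
  ring

theorem homEval_add {n k : ℕ} (A A' : Coeffs n k) (α β : ℂ) :
    homEval (A + A') α β = homEval A α β + homEval A' α β := by
  simp [homEval, Finset.sum_add_distrib]

theorem homEval_const_smul {n k : ℕ} (c : ℂ) (A : Coeffs n k) (α β : ℂ) :
    homEval (c • A) α β = c • homEval A α β := by
  simp only [homEval, Finset.smul_sum, Pi.smul_apply]
  exact Finset.sum_congr rfl fun i _ => smul_comm _ _ _

theorem eval_detForm {n k : ℕ} (B : Coeffs n k) (α β : ℂ) :
    MvPolynomial.eval ![α, β] (detForm B) = (homEval B α β).det := by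
  unfold detForm homEval
  rw [RingHom.map_det]
  congr 1
  ext a b
  simp [Matrix.sum_apply]

/-- A polynomial in two indeterminates that vanishes on a line through the origin is divisible by
the linear form that defines the line. -/
theorem linearForm_dvd_of_eval_eq_zero {α₀ β₀ : ℂ} (h0 : (α₀, β₀) ≠ (0, 0))
    {q : MvPolynomial (Fin 2) ℂ}
    (hq : ∀ s : ℂ, MvPolynomial.eval ![s * α₀, s * β₀] q = 0) :
    (MvPolynomial.C β₀ * MvPolynomial.X 0 - MvPolynomial.C α₀ * MvPolynomial.X 1 :
        MvPolynomial (Fin 2) ℂ) ∣ q := by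
  -- With `m = a X₀ + b X₁`, the differences `X₀ - m α₀ = b ℓ` and `X₁ - m β₀ = -a ℓ` show that
  -- modulo `ℓ` the polynomial `q` equals `q(m α₀, m β₀)`, which is zero by hypothesis.
  obtain ⟨a, b, hab⟩ : ∃ a b : ℂ, a * α₀ + b * β₀ = 1 := by
    by_cases h : α₀ = 0
    · have hb : β₀ ≠ 0 := fun hb => h0 (by rw [h, hb])
      exact ⟨0, β₀⁻¹, by field_simp; ring⟩
    · exact ⟨α₀⁻¹, 0, by field_simp; ring⟩
  set ℓ : MvPolynomial (Fin 2) ℂ :=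
    MvPolynomial.C β₀ * MvPolynomial.X 0 - MvPolynomial.C α₀ * MvPolynomial.X 1 with hℓ
  set m : MvPolynomial (Fin 2) ℂ :=
    MvPolynomial.C a * MvPolynomial.X 0 + MvPolynomial.C b * MvPolynomial.X 1 with hm
  have hC : (MvPolynomial.C a * MvPolynomial.C α₀ + MvPolynomial.C b * MvPolynomial.C β₀ :
      MvPolynomial (Fin 2) ℂ) = 1 := by
    rw [← MvPolynomial.C_mul, ← MvPolynomial.C_mul, ← MvPolynomial.C_add, hab, MvPolynomial.C_1]
  set I : Ideal (MvPolynomial (Fin 2) ℂ) := Ideal.span {ℓ} with hI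
  have hsub : MvPolynomial.aeval ![m * MvPolynomial.C α₀, m * MvPolynomial.C β₀] q = 0 := by
    set Q : Polynomial ℂ := MvPolynomial.aeval
      ![Polynomial.X * Polynomial.C α₀, Polynomial.X * Polynomial.C β₀] q with hQ
    have hQ0 : Q = 0 := by
      refine Polynomial.funext fun s => ?_
      rw [Polynomial.eval_zero, ← hq s, hQ, ← Polynomial.coe_evalRingHom, MvPolynomial.aeval_def,
        MvPolynomial.hom_eval₂, MvPolynomial.eval, MvPolynomial.coe_eval₂Hom]
      congr 1
      · ext; simp
      · ext i; fin_cases i <;> simp <;> exact mul_comm _ _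
    have : MvPolynomial.aeval ![m * MvPolynomial.C α₀, m * MvPolynomial.C β₀] q =
        Polynomial.aeval m Q := by
      rw [hQ, ← AlgHom.comp_apply]
      congr 1
      refine MvPolynomial.algHom_ext fun i => ?_
      fin_cases i <;> simp [MvPolynomial.algebraMap_eq] <;> exact mul_comm _ _
    rw [this, hQ0, map_zero]
  have hmk : Ideal.Quotient.mk I q = 0 := by
    rw [← map_zero (Ideal.Quotient.mk I), ← hsub]
    have : (Ideal.Quotient.mkₐ ℂ I) = (Ideal.Quotient.mkₐ ℂ I).comp
        (MvPolynomial.aeval ![m * MvPolynomial.C α₀, m * MvPolynomial.C β₀]) := by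
      refine MvPolynomial.algHom_ext fun i => ?_
      rw [AlgHom.comp_apply, MvPolynomial.aeval_X, Ideal.Quotient.mkₐ_eq_mk]
      refine (Ideal.Quotient.mk_eq_mk_iff_sub_mem _ _).mpr (Ideal.mem_span_singleton.mpr ?_)
      fin_cases i
      · refine ⟨MvPolynomial.C b, ?_⟩
        simp only [Fin.zero_eta, Matrix.cons_val_zero]
        linear_combination (-MvPolynomial.X 0 : MvPolynomial (Fin 2) ℂ) * hC
      · refine ⟨-MvPolynomial.C a, ?_⟩
        simp only [Fin.mk_one, Matrix.cons_val_one, Matrix.cons_val_fin_one]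
        linear_combination (-MvPolynomial.X 1 : MvPolynomial (Fin 2) ℂ) * hC
    exact DFunLike.congr_fun this q
  exact Ideal.mem_span_singleton.mp (Ideal.Quotient.eq_zero_iff_mem.mp hmk)

/-- The characteristic function of the eigenvalues of `A` in the affine chart
`t ↦ (α₀, β₀) + t (-conj β₀, conj α₀)` of the projective line. -/
noncomputable def chartDet {n k : ℕ} (α₀ β₀ : ℂ) (A : Coeffs n k) (t : ℂ) : ℂ :=
  (homEval A (α₀ - t * conj β₀) (β₀ + t * conj α₀)).det

theorem sq_norm_add_sq_norm_pos {α₀ β₀ : ℂ} (h0 : (α₀, β₀) ≠ (0, 0)) :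
    0 < ‖α₀‖ ^ 2 + ‖β₀‖ ^ 2 := by
  by_cases h : α₀ = 0
  · have hb : β₀ ≠ 0 := fun hb => h0 (by rw [h, hb])
    have := norm_pos_iff.mpr hb
    positivity
  · have := norm_pos_iff.mpr h
    positivity

/-- Write `det P = ℓ q` with `ℓ ∤ q`; the derivative is then `-(|α₀|² + |β₀|²) q(α₀, β₀)`.
Non-divisibility only says that `q` is not identically zero on the line of the eigenvalue; a
homogeneity relation for `q` on that line moves this to the point `(α₀, β₀)` itself. -/
theorem IsSimpleEigenvalue.exists_hasDerivAt {n k : ℕ} {B : Coeffs n k} {α₀ β₀ : ℂ}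
    (h : IsSimpleEigenvalue B α₀ β₀) :
    (homEval B α₀ β₀).det = 0 ∧ ∃ c ≠ 0, HasDerivAt (chartDet α₀ β₀ B) c 0 := by
  obtain ⟨h0, hmult⟩ := h
  rw [← Nat.cast_one, emultiplicity_eq_coe, pow_one] at hmult
  obtain ⟨⟨q, hq⟩, hnd⟩ := hmult
  have hev : ∀ a b : ℂ, (homEval B a b).det =
      (β₀ * a - α₀ * b) * MvPolynomial.eval ![a, b] q := by
    intro a b
    rw [← eval_detForm, hq]
    simp
  refine ⟨by rw [hev]; ring, ?_⟩
  have hne : (-(β₀ * conj β₀) - α₀ * conj α₀ : ℂ) ≠ 0 := by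
    rw [Complex.mul_conj', Complex.mul_conj']
    have := sq_norm_add_sq_norm_pos h0
    intro h
    have h' : -‖β₀‖ ^ 2 - ‖α₀‖ ^ 2 = 0 := by exact_mod_cast h
    linarith
  have hqd : ∀ s : ℂ, Continuous fun t : ℂ =>
      MvPolynomial.eval ![s * (α₀ - t * conj β₀), s * (β₀ + t * conj α₀)] q := by
    intro s
    refine (MvPolynomial.continuous_eval q).comp (continuous_pi fun i => ?_)
    fin_cases i <;> simp <;> fun_prop
  -- `q` is homogeneous, up to a scalar, on the line of the eigenvalue
  have hline : ∀ s : ℂ, s ≠ 0 → s * MvPolynomial.eval ![s * α₀, s * β₀] q =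
      (s ^ k) ^ n * MvPolynomial.eval ![α₀, β₀] q := by
    intro s hs
    have hcont : Continuous fun t : ℂ => s * MvPolynomial.eval
        ![s * (α₀ - t * conj β₀), s * (β₀ + t * conj α₀)] q - (s ^ k) ^ n *
          MvPolynomial.eval ![1 * (α₀ - t * conj β₀), 1 * (β₀ + t * conj α₀)] q :=
      ((hqd s).const_mul s).sub ((hqd 1).const_mul _)
    -- Off the line, `ℓ` is nonzero and can be cancelled from the homogeneity relation of `det P`;
    -- continuity then gives the limit `t → 0`.
    have hz : ∀ᶠ t in 𝓝[≠] (0 : ℂ), s * MvPolynomial.eval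
        ![s * (α₀ - t * conj β₀), s * (β₀ + t * conj α₀)] q - (s ^ k) ^ n *
          MvPolynomial.eval ![1 * (α₀ - t * conj β₀), 1 * (β₀ + t * conj α₀)] q = 0 := by
      filter_upwards [self_mem_nhdsWithin] with t ht
      have h1 := hev (s * (α₀ - t * conj β₀)) (s * (β₀ + t * conj α₀))
      rw [homEval_smul, Matrix.det_smul, hev, Fintype.card_fin] at h1
      have ht' : t * (-(β₀ * conj β₀) - α₀ * conj α₀) ≠ 0 := mul_ne_zero ht hne
      apply mul_left_cancel₀ ht'
      simp only [one_mul]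
      linear_combination -h1
    have hlim := (hcont.tendsto 0).mono_left (nhdsWithin_le_nhds (s := {0}ᶜ))
    have := tendsto_nhds_unique hlim (tendsto_const_nhds.congr' (hz.mono fun t ht => ht.symm))
    simp only [zero_mul, sub_zero, add_zero, one_mul] at this
    linear_combination this
  have hq0 : MvPolynomial.eval ![α₀, β₀] q ≠ 0 := by
    intro hz
    apply hnd
    have hzero : ∀ s : ℂ, s ≠ 0 → MvPolynomial.eval ![s * α₀, s * β₀] q = 0 := fun s hs => by
      have := hline s hs
      rw [hz, mul_zero] at this
      exact (mul_eq_zero.mp this).resolve_left hs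
    have hall : ∀ s : ℂ, MvPolynomial.eval ![s * α₀, s * β₀] q = 0 := by
      intro s
      have hcont : Continuous fun s : ℂ => MvPolynomial.eval ![s * α₀, s * β₀] q := by
        refine (MvPolynomial.continuous_eval q).comp (continuous_pi fun i => ?_)
        fin_cases i <;> simp <;> fun_prop
      by_cases hs : s = 0
      · subst hs
        have hlim := (hcont.tendsto 0).mono_left (nhdsWithin_le_nhds (s := {0}ᶜ))
        refine tendsto_nhds_unique hlim (tendsto_const_nhds.congr' ?_)
        filter_upwards [self_mem_nhdsWithin] with t ht
        exact (hzero t ht).symm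
      · exact hzero s hs
    obtain ⟨q', hq'⟩ := linearForm_dvd_of_eval_eq_zero h0 hall
    exact ⟨q', by rw [hq, hq']; ring⟩
  refine ⟨(-(β₀ * conj β₀) - α₀ * conj α₀) * MvPolynomial.eval ![α₀, β₀] q,
    mul_ne_zero hne hq0, ?_⟩
  rw [hasDerivAt_iff_tendsto_slope]
  have hlim := ((hqd 1).const_mul (-(β₀ * conj β₀) - α₀ * conj α₀)).tendsto 0
  simp only [zero_mul, sub_zero, add_zero, one_mul] at hlim
  refine (hlim.mono_left (nhdsWithin_le_nhds (s := {0}ᶜ))).congr' ?_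
  filter_upwards [self_mem_nhdsWithin] with t ht
  have ht : t ≠ 0 := ht
  simp only [slope_def_field, chartDet, hev]
  field_simp
  ring

/-! ### Rank-one adjugates, spectral and Frobenius norms. -/

/-- The adjugate of a singular matrix has rank at most one. -/
theorem exists_adjugate_eq_vecMulVec {n : ℕ} {N : Matrix (Fin n) (Fin n) ℂ} (hN : N.det = 0)
    (hadj : N.adjugate ≠ 0) :
    ∃ x y : Fin n → ℂ, x ≠ 0 ∧ y ≠ 0 ∧ N.adjugate = vecMulVec x y := by
  obtain ⟨i, j, hij⟩ : ∃ i j, N.adjugate i j ≠ 0 := by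
    by_contra! h
    exact hadj (by ext a b; exact h a b)
  -- The cofactor `N.adjugate i j` is the determinant of `N` with row `j` replaced by the `i`-th
  -- unit row; a kernel vector of `N` with `v i = 0` is also killed by that matrix.
  have hker : ∀ v : Fin n → ℂ, N *ᵥ v = 0 → v i = 0 → v = 0 := by
    intro v hv hvi
    by_contra hne
    apply hij
    rw [Matrix.adjugate_apply]
    refine Matrix.exists_mulVec_eq_zero_iff.mp ⟨v, hne, ?_⟩
    ext a
    by_cases ha : a = j
    · subst ha
      simp [Matrix.mulVec, Matrix.updateRow_self, hvi]
    · have := congrFun hv a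
      simpa [Matrix.mulVec, Matrix.updateRow_ne ha] using this
  have hcol : ∀ l, N *ᵥ (fun a => N.adjugate a l) = 0 := by
    intro l
    have := Matrix.mul_adjugate N
    rw [hN, zero_smul] at this
    ext a
    exact congrFun (congrFun this a) l
  refine ⟨fun a => N.adjugate a j, fun l => N.adjugate i l / N.adjugate i j,
    fun h => hij (congrFun h i), fun h => ?_, ?_⟩
  · have := congrFun h j
    simp [hij] at this
  · ext a l
    have hz := hker (fun a => N.adjugate a l - (N.adjugate i l / N.adjugate i j) * N.adjugate a j)
      (by
        have : (fun a => N.adjugate a l - (N.adjugate i l / N.adjugate i j) * N.adjugate a j) =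
          (fun a => N.adjugate a l) - (N.adjugate i l / N.adjugate i j) •
            (fun a => N.adjugate a j) := rfl
        rw [this, Matrix.mulVec_sub, Matrix.mulVec_smul, hcol, hcol, smul_zero, sub_zero])
      (by simp [hij])
    have := congrFun hz a
    simp only [Pi.zero_apply, sub_eq_zero] at this
    rw [vecMulVec_apply, this, mul_comm]

theorem specNorm_le_norm {n : ℕ} (A : Matrix (Fin n) (Fin n) ℂ) : specNorm A ≤ ‖A‖ := by
  refine ContinuousLinearMap.opNorm_le_bound _ (norm_nonneg _) fun x => ?_
  have h1 := Matrix.frobenius_norm_mul A (replicateCol Unit x.ofLp)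
  rw [← Matrix.replicateCol_mulVec, Matrix.frobenius_norm_replicateCol,
    Matrix.frobenius_norm_replicateCol] at h1
  exact h1

theorem norm_apply_le_specNorm {n : ℕ} (A : Matrix (Fin n) (Fin n) ℂ) (i j : Fin n) :
    ‖A i j‖ ≤ specNorm A := by
  have h1 := (Matrix.toEuclideanCLM (n := Fin n) (𝕜 := ℂ) A).le_opNorm
    (EuclideanSpace.single j 1)
  rw [PiLp.norm_single, norm_one, mul_one] at h1
  refine le_trans (le_of_eq ?_) ((PiLp.norm_apply_le _ i).trans h1)
  simp [EuclideanSpace.single]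

/-- The constant is not sharp; it only serves to make spectrally small perturbations small in the
coefficient space. -/
theorem norm_le_mul_specNorm {n : ℕ} (A : Matrix (Fin n) (Fin n) ℂ) : ‖A‖ ≤ n * specNorm A := by
  have hs : 0 ≤ specNorm A := norm_nonneg _
  rw [Matrix.frobenius_norm_def, ← Real.sqrt_eq_rpow]
  refine Real.sqrt_le_iff.mpr ⟨by positivity, ?_⟩
  have : ∀ i ∈ Finset.univ, ∑ j, ‖A i j‖ ^ (2 : ℝ) ≤ n * specNorm A ^ 2 := fun i _ => by
    have : ∀ j ∈ Finset.univ, ‖A i j‖ ^ (2 : ℝ) ≤ specNorm A ^ 2 := fun j _ => by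
      rw [Real.rpow_two]
      exact pow_le_pow_left₀ (norm_nonneg _) (norm_apply_le_specNorm A i j) 2
    simpa using Finset.sum_le_card_nsmul _ _ _ this
  have := Finset.sum_le_card_nsmul _ _ _ this
  simp only [Finset.card_univ, Fintype.card_fin, nsmul_eq_mul] at this
  linarith

/-- A nonzero functional `E ↦ tr(x yᵀ E)` has the same norm with respect to the spectral and to the
Frobenius norm, and it attains this norm at a common unit matrix. -/
theorem exists_dual_norm_vecMulVec {n : ℕ} {x y : Fin n → ℂ} (hx : x ≠ 0) (hy : y ≠ 0) :
    ∃ R : ℝ, 0 < R ∧ (∀ E : Matrix (Fin n) (Fin n) ℂ,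
      ‖(vecMulVec x y * E).trace‖ ≤ R * specNorm E) ∧
      ∃ E : Matrix (Fin n) (Fin n) ℂ, ‖E‖ ≤ 1 ∧ (vecMulVec x y * E).trace = R := by
  have htr : ∀ E : Matrix (Fin n) (Fin n) ℂ, (vecMulVec x y * E).trace = y ⬝ᵥ (E *ᵥ x) := by
    intro E
    rw [Matrix.vecMulVec_mul, Matrix.trace_vecMulVec, dotProduct_comm, Matrix.dotProduct_mulVec]
  have hxn : 0 < ‖WithLp.toLp 2 x‖ := norm_pos_iff.mpr (by simpa using hx)
  have hyn : 0 < ‖WithLp.toLp 2 y‖ := norm_pos_iff.mpr (by simpa using hy)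
  have hstar : ∀ v : Fin n → ℂ, ‖WithLp.toLp 2 (star v)‖ = ‖WithLp.toLp 2 v‖ := by
    intro v
    simp [EuclideanSpace.norm_eq]
  have hself : ∀ v : Fin n → ℂ, v ⬝ᵥ star v = ((‖WithLp.toLp 2 v‖ ^ 2 : ℝ) : ℂ) := by
    intro v
    simp [EuclideanSpace.norm_sq_eq, dotProduct, Complex.mul_conj']
  -- The trace is `yᵀ E x`, so Cauchy–Schwarz gives the bound, with equality at the normalised
  -- rank-one matrix `ȳ x*`.
  refine ⟨‖WithLp.toLp 2 y‖ * ‖WithLp.toLp 2 x‖, by positivity, fun E => ?_,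
    ((‖WithLp.toLp 2 y‖ * ‖WithLp.toLp 2 x‖ : ℝ) : ℂ)⁻¹ • vecMulVec (star y) (star x), ?_, ?_⟩
  · rw [htr]
    have h1 : y ⬝ᵥ (E *ᵥ x) = inner ℂ (WithLp.toLp 2 (star y)) (WithLp.toLp 2 (E *ᵥ x)) := by
      simp [PiLp.inner_apply, dotProduct, mul_comm]
    have h2 : ‖WithLp.toLp 2 (E *ᵥ x)‖ ≤ specNorm E * ‖WithLp.toLp 2 x‖ :=
      (Matrix.toEuclideanCLM (n := Fin n) (𝕜 := ℂ) E).le_opNorm (WithLp.toLp 2 x)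
    rw [h1]
    refine (norm_inner_le_norm _ _).trans ?_
    rw [hstar]
    calc _ ≤ ‖WithLp.toLp 2 y‖ * (specNorm E * ‖WithLp.toLp 2 x‖) := by gcongr
      _ = _ := by ring
  · have h1 : ‖vecMulVec (star y) (star x)‖ ≤ ‖WithLp.toLp 2 y‖ * ‖WithLp.toLp 2 x‖ := by
      rw [Matrix.vecMulVec_eq Unit]
      refine (Matrix.frobenius_norm_mul _ _).trans_eq ?_
      rw [Matrix.frobenius_norm_replicateCol, Matrix.frobenius_norm_replicateRow, hstar, hstar]
    rw [norm_smul, norm_inv, Complex.norm_of_nonneg (by positivity)]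
    rw [inv_mul_le_iff₀ (by positivity), mul_one]
    exact h1
  · rw [Matrix.mul_smul, Matrix.trace_smul, htr, Matrix.vecMulVec_mulVec, dotProduct_comm (star x),
      hself]
    simp only [MulOpposite.smul_eq_mul_unop, dotProduct_smul, MulOpposite.unop_op, hself]
    push_cast
    have : (‖WithLp.toLp 2 x‖ : ℂ) ≠ 0 := by exact_mod_cast hxn.ne'
    have : (‖WithLp.toLp 2 y‖ : ℂ) ≠ 0 := by exact_mod_cast hyn.ne'
    simp only [smul_eq_mul]
    field_simp

/-! ### The local eigenvalue branch. -/

/-- The implicit function theorem for one scalar unknown, with the derivative of the implicit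
function expressed through directional derivatives. -/
theorem exists_implicit_scalar {E : Type*} [NormedAddCommGroup E] [NormedSpace ℂ E]
    [CompleteSpace E] {f : E × ℂ → ℂ} {b : E} (hf : ContDiff ℂ 1 f) (h0 : f (b, 0) = 0)
    {c : ℂ} (hc : c ≠ 0) (hdt : HasDerivAt (fun t => f (b, t)) c 0)
    {ℓ : E → ℂ} (hdE : ∀ H, HasDerivAt (fun s : ℂ => f (b + s • H, 0)) (ℓ H) 0) :
    ∃ (φ : E → ℂ) (L : E →L[ℂ] ℂ), φ b = 0 ∧ HasFDerivAt φ L b ∧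
      (∀ᶠ v in 𝓝 (b, (0 : ℂ)), f v = 0 ↔ φ v.1 = v.2) ∧ ∀ H, L H = -(c⁻¹ * ℓ H) := by
  have hs : HasStrictFDerivAt f (fderiv ℂ f (b, 0)) (b, 0) :=
    hf.contDiffAt.hasStrictFDerivAt one_ne_zero
  set f' := fderiv ℂ f (b, 0)
  have hf't : ∀ t : ℂ, f' (0, t) = t * c := by
    have h1 : HasDerivAt (fun t : ℂ => f (b, t)) (f' (0, 1)) 0 :=
      hs.hasFDerivAt.comp_hasDerivAt (0 : ℂ) ((hasDerivAt_const (0 : ℂ) b).prodMk (hasDerivAt_id 0))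
    intro t
    rw [← h1.unique hdt, ← smul_eq_mul, ← map_smul]
    simp
  have hf'E : ∀ H, f' (H, 0) = ℓ H := by
    intro H
    have hline : HasDerivAt (fun s : ℂ => b + s • H) H 0 := by
      simpa using ((hasDerivAt_id (0 : ℂ)).smul_const H).const_add b
    have hpair : HasDerivAt (fun s : ℂ => (b + s • H, (0 : ℂ))) (H, (0 : ℂ)) 0 :=
      hline.prodMk (hasDerivAt_const (0 : ℂ) (0 : ℂ))
    have hs' : HasFDerivAt f f' ((fun s : ℂ => (b + s • H, (0 : ℂ))) 0) := by
      simpa using hs.hasFDerivAt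
    have h1 : HasDerivAt (fun s : ℂ => f (b + s • H, 0)) (f' (H, 0)) 0 :=
      HasFDerivAt.comp_hasDerivAt (0 : ℂ) hs' hpair
    exact h1.unique (hdE H)
  have hinv : (f' ∘L .inr ℂ E ℂ).IsInvertible := by
    refine ⟨ContinuousLinearEquiv.unitsEquivAut ℂ (Units.mk0 c hc), ?_⟩
    ext
    simp [hf't]
  refine ⟨hs.implicitFunctionOfProdDomain hinv, _, ?_,
    (hs.hasStrictFDerivAt_implicitFunctionOfProdDomain hinv).hasFDerivAt, ?_, fun H => ?_⟩
  · exact (hs.eventually_apply_eq_iff_implicitFunctionOfProdDomain hinv).self_of_nhds.mp rfl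
  · have := hs.eventually_apply_eq_iff_implicitFunctionOfProdDomain hinv
    rwa [h0] at this
  · have h2 : ∀ u : ℂ, (f' ∘L .inr ℂ E ℂ).inverse u = c⁻¹ * u := by
      intro u
      apply hinv.injective
      rw [hinv.self_apply_inverse]
      simp [hf't]
      field_simp
    simp [h2, hf'E]

theorem contDiff_chartDet {n k : ℕ} (α₀ β₀ : ℂ) :
    ContDiff ℂ 1 fun v : Coeffs n k × ℂ => chartDet α₀ β₀ v.1 v.2 := by
  have hentry : ∀ (l : Fin (k + 1)) (i j : Fin n), ContDiff ℂ 1 fun A : Coeffs n k => A l i j := by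
    intro l i j
    let f : Coeffs n k →ₗ[ℂ] ℂ := (Matrix.entryLinearMap ℂ ℂ i j).comp (LinearMap.proj l)
    refine (f.mkContinuous 1 fun A => ?_).contDiff
    rw [one_mul]
    exact ((norm_apply_le_specNorm _ i j).trans (specNorm_le_norm _)).trans (norm_le_pi_norm A l)
  unfold chartDet homEval
  simp only [Matrix.det_apply', Matrix.sum_apply, Matrix.smul_apply, smul_eq_mul]
  refine ContDiff.sum fun σ _ => contDiff_const.mul (contDiff_prod fun i _ => ContDiff.sum fun l _ =>
    ContDiff.mul ?_ ((hentry l _ _).comp contDiff_fst))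
  fun_prop

/-- Near a simple eigenvalue, the eigenvalues of the nearby polynomials are given in the chart
`chartDet` by a differentiable function, the derivative of which is, up to the factors
`α₀^i β₀^(k-i)`, a functional `τ` on matrices that has the same norm for the spectral and for the
Frobenius norm. -/
theorem IsSimpleEigenvalue.exists_branch {n k : ℕ} {B : Coeffs n k} {α₀ β₀ : ℂ}
    (h : IsSimpleEigenvalue B α₀ β₀) :
    ∃ (φ : Coeffs n k → ℂ) (L : Coeffs n k →L[ℂ] ℂ) (τ : Matrix (Fin n) (Fin n) ℂ →ₗ[ℂ] ℂ) (R : ℝ),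
      φ B = 0 ∧ HasFDerivAt φ L B ∧
      (∀ᶠ v in 𝓝 (B, (0 : ℂ)), chartDet α₀ β₀ v.1 v.2 = 0 ↔ φ v.1 = v.2) ∧
      (∀ H, L H = ∑ i : Fin (k + 1), (α₀ ^ (i : ℕ) * β₀ ^ (k - (i : ℕ))) * τ (H i)) ∧
      0 < R ∧ (∀ E, ‖τ E‖ ≤ R * specNorm E) ∧ ∃ E, ‖E‖ ≤ 1 ∧ τ E = R := by
  obtain ⟨hdet, c, hc, hdt⟩ := h.exists_hasDerivAt
  set N := homEval B α₀ β₀ with hN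
  -- the derivative in the direction of the chart shows that the adjugate does not vanish
  have hadj : N.adjugate ≠ 0 := by
    intro h0
    have hd : ∀ i j, DifferentiableAt ℂ
        (fun t : ℂ => homEval B (α₀ - t * conj β₀) (β₀ + t * conj α₀) i j) 0 := by
      intro i j
      simp only [homEval, Matrix.sum_apply, Matrix.smul_apply, smul_eq_mul]
      fun_prop
    have h1 := hasDerivAt_det (M := fun t : ℂ => homEval B (α₀ - t * conj β₀) (β₀ + t * conj α₀))
      (M' := Matrix.of fun i j => deriv
        (fun t : ℂ => homEval B (α₀ - t * conj β₀) (β₀ + t * conj α₀) i j) 0)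
      (t := 0) fun i j => (hd i j).hasDerivAt
    simp only [zero_mul, sub_zero, add_zero, ← hN, h0, Matrix.trace_zero] at h1
    exact hc (hdt.unique h1)
  obtain ⟨x, y, hx, hy, hxy⟩ := exists_adjugate_eq_vecMulVec hdet hadj
  have hdE : ∀ H : Coeffs n k, HasDerivAt (fun s : ℂ => chartDet α₀ β₀ (B + s • H) 0)
      ((N.adjugate * homEval H α₀ β₀).trace) 0 := by
    intro H
    have h1 := hasDerivAt_det (M := fun s : ℂ => N + s • homEval H α₀ β₀)
      (M' := homEval H α₀ β₀) (t := 0) fun i j => by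
        simpa using ((hasDerivAt_id (0 : ℂ)).mul_const (homEval H α₀ β₀ i j)).const_add (N i j)
    simpa [chartDet, homEval_add, homEval_const_smul] using h1
  have : CompleteSpace (Coeffs n k) := FiniteDimensional.complete ℂ _
  obtain ⟨φ, L, hφ0, hφ, hφe, hL⟩ := exists_implicit_scalar
    (f := fun v : Coeffs n k × ℂ => chartDet α₀ β₀ v.1 v.2) (b := B) (contDiff_chartDet α₀ β₀)
    (by simpa [chartDet] using hdet) hc hdt hdE
  -- The factor `-c⁻¹` of the implicit derivative is absorbed into `x`, which keeps the functional
  -- of the form `tr (x yᵀ E)`.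
  have hx' : (-c⁻¹) • x ≠ 0 := smul_ne_zero (neg_ne_zero.mpr (inv_ne_zero hc)) hx
  obtain ⟨R, hR, hRle, hE⟩ := exists_dual_norm_vecMulVec hx' hy
  refine ⟨φ, L, (Matrix.traceLinearMap (Fin n) ℂ ℂ).comp
    (LinearMap.mulLeft ℂ (vecMulVec ((-c⁻¹) • x) y)), R, hφ0, hφ, hφe, fun H => ?_, hR, hRle, hE⟩
  refine (hL H).trans ?_
  rw [hxy]
  simp only [homEval, Matrix.mul_sum, Matrix.trace_sum, Matrix.mul_smul, Matrix.trace_smul,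
    LinearMap.comp_apply, LinearMap.mulLeft_apply, Matrix.traceLinearMap_apply,
    Matrix.smul_vecMulVec, Matrix.smul_mul, smul_eq_mul]
  rw [Finset.mul_sum, ← Finset.sum_neg_distrib]
  exact Finset.sum_congr rfl fun i _ => by ring

/-! ### Geometry of the chart and the chordal distance. -/

/-- A vector orthogonal to `(α₀, β₀)` of the same length. -/
noncomputable def orthVec (α₀ β₀ : ℂ) : EuclideanSpace ℂ (Fin 2) := !₂[-conj β₀, conj α₀]

theorem norm_sq_pair (a b : ℂ) :
    ‖(!₂[a, b] : EuclideanSpace ℂ (Fin 2))‖ ^ 2 = ‖a‖ ^ 2 + ‖b‖ ^ 2 := by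
  simp [EuclideanSpace.norm_sq_eq, Fin.sum_univ_two]

theorem norm_orthVec (α₀ β₀ : ℂ) :
    ‖orthVec α₀ β₀‖ = ‖(!₂[α₀, β₀] : EuclideanSpace ℂ (Fin 2))‖ := by
  rw [← sq_eq_sq₀ (norm_nonneg _) (norm_nonneg _), orthVec, norm_sq_pair, norm_sq_pair]
  simp [add_comm]

theorem inner_pair (a b c d : ℂ) :
    inner ℂ (!₂[a, b] : EuclideanSpace ℂ (Fin 2)) !₂[c, d] = c * conj a + d * conj b := by
  simp [PiLp.inner_apply, Fin.sum_univ_two]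

theorem norm_pair_pos {α₀ β₀ : ℂ} (h0 : (α₀, β₀) ≠ (0, 0)) :
    0 < ‖(!₂[α₀, β₀] : EuclideanSpace ℂ (Fin 2))‖ := by
  have h1 := sq_norm_add_sq_norm_pos h0
  rw [← norm_sq_pair] at h1
  exact (sq_pos_iff.mp h1).lt_of_le' (norm_nonneg _)

/-- The chordal distance is computed from the coordinate in the affine chart of the projective
line. -/
theorem chordalDist_chart {α₀ β₀ : ℂ} (h0 : (α₀, β₀) ≠ (0, 0)) {s : ℂ} (hs : s ≠ 0) (t : ℂ) :
    chordalDist !₂[α₀, β₀] !₂[s * (α₀ - t * conj β₀), s * (β₀ + t * conj α₀)] =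
      ‖t‖ / √(1 + ‖t‖ ^ 2) := by
  have hz := norm_pair_pos h0
  set z := ‖(!₂[α₀, β₀] : EuclideanSpace ℂ (Fin 2))‖ with hzdef
  have hzc : (α₀ * conj α₀ + β₀ * conj β₀ : ℂ) = ((z ^ 2 : ℝ) : ℂ) := by
    rw [hzdef, norm_sq_pair, Complex.mul_conj', Complex.mul_conj']
    push_cast
    ring
  have hin : ‖inner ℂ (!₂[α₀, β₀] : EuclideanSpace ℂ (Fin 2))
      !₂[s * (α₀ - t * conj β₀), s * (β₀ + t * conj α₀)]‖ = ‖s‖ * z ^ 2 := by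
    rw [inner_pair]
    have : s * (α₀ - t * conj β₀) * conj α₀ + s * (β₀ + t * conj α₀) * conj β₀ =
        s * ((z ^ 2 : ℝ) : ℂ) := by
      rw [← hzc]
      ring
    rw [this, norm_mul, Complex.norm_of_nonneg (by positivity)]
  have hnorm : ‖(!₂[s * (α₀ - t * conj β₀), s * (β₀ + t * conj α₀)] :
      EuclideanSpace ℂ (Fin 2))‖ = ‖s‖ * z * √(1 + ‖t‖ ^ 2) := by
    rw [← sq_eq_sq₀ (norm_nonneg _) (by positivity), mul_pow, mul_pow,
      Real.sq_sqrt (by positivity), norm_sq_pair, norm_mul, norm_mul]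
    -- The identity is proved in `ℂ`, where `‖w‖² = w * conj w` turns it into a ring identity.
    have h1 : ((‖α₀ - t * conj β₀‖ ^ 2 + ‖β₀ + t * conj α₀‖ ^ 2 : ℝ) : ℂ) =
        ((z ^ 2 * (1 + ‖t‖ ^ 2) : ℝ) : ℂ) := by
      rw [Complex.ofReal_mul, ← hzc]
      push_cast
      rw [← Complex.mul_conj', ← Complex.mul_conj', ← Complex.mul_conj']
      simp only [map_sub, map_add, map_mul, Complex.conj_conj]
      ring
    have h2 : ‖α₀ - t * conj β₀‖ ^ 2 + ‖β₀ + t * conj α₀‖ ^ 2 = z ^ 2 * (1 + ‖t‖ ^ 2) := by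
      exact_mod_cast h1
    rw [mul_pow, mul_pow, ← mul_add, h2]
    ring
  have hs' : 0 < ‖s‖ := norm_pos_iff.mpr hs
  have hq : 0 < √(1 + ‖t‖ ^ 2) := Real.sqrt_pos.mpr (by positivity)
  have hratio : ‖s‖ * z ^ 2 / (z * (‖s‖ * z * √(1 + ‖t‖ ^ 2))) = 1 / √(1 + ‖t‖ ^ 2) := by
    field_simp
  rw [chordalDist, lineAngle, Real.sin_arccos, hin, hnorm, hratio]
  rw [← Real.sqrt_sq (norm_nonneg t), ← Real.sqrt_div (by positivity), Real.sqrt_sq (norm_nonneg t)]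
  congr 1
  rw [div_pow, Real.sq_sqrt (by positivity)]
  field_simp
  ring

theorem chordalDist_le_one (x y : EuclideanSpace ℂ (Fin 2)) : chordalDist x y ≤ 1 :=
  Real.sin_le_one _

/-- Lines that are not orthogonal to `(α₀, β₀)` lie in the affine chart. -/
theorem exists_chart_of_chordalDist_lt_one {α₀ β₀ : ℂ} (h0 : (α₀, β₀) ≠ (0, 0)) {α β : ℂ}
    (h : chordalDist !₂[α₀, β₀] !₂[α, β] < 1) :
    ∃ s t : ℂ, s ≠ 0 ∧ α = s * (α₀ - t * conj β₀) ∧ β = s * (β₀ + t * conj α₀) := by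
  -- An inner product equal to zero would give distance `1`. This also excludes `α = β = 0`, where
  -- the quotient `0 / 0` is `0`.
  have hne : α * conj α₀ + β * conj β₀ ≠ 0 := by
    intro hz
    rw [chordalDist, lineAngle, inner_pair, hz] at h
    simp at h
  have hz : (α₀ * conj α₀ + β₀ * conj β₀ : ℂ) ≠ 0 := by
    rw [Complex.mul_conj', Complex.mul_conj']
    have := sq_norm_add_sq_norm_pos h0
    exact_mod_cast this.ne'
  -- `s` and `s t` are the coordinates of `(α, β)` in the orthogonal basis formed by `(α₀, β₀)` and
  -- `orthVec α₀ β₀`.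
  refine ⟨(α * conj α₀ + β * conj β₀) / (α₀ * conj α₀ + β₀ * conj β₀),
    (α₀ * β - β₀ * α) / (α * conj α₀ + β * conj β₀), div_ne_zero hne hz, ?_, ?_⟩
  · rw [eq_comm, div_mul_eq_mul_div, div_eq_iff hz, mul_sub, ← mul_assoc, mul_div_cancel₀ _ hne]
    ring
  · rw [eq_comm, div_mul_eq_mul_div, div_eq_iff hz, mul_add, ← mul_assoc, mul_div_cancel₀ _ hne]
    ring

theorem chartDet_eq_zero_of_mulVec {n k : ℕ} {α₀ β₀ : ℂ} {A : Coeffs n k} {s t : ℂ} (hs : s ≠ 0)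
    {v : Fin n → ℂ} (hv : v ≠ 0)
    (h : homEval A (s * (α₀ - t * conj β₀)) (s * (β₀ + t * conj α₀)) *ᵥ v = 0) :
    chartDet α₀ β₀ A t = 0 := by
  refine Matrix.exists_mulVec_eq_zero_iff.mp ⟨v, hv, ?_⟩
  rw [homEval_smul, Matrix.smul_mulVec] at h
  exact (smul_eq_zero.mp h).resolve_left (pow_ne_zero _ hs)

/-- The orthogonal complement of a line in `ℂ²` is one-dimensional. The explicit coefficient makes
the chart coordinate of a representative depend continuously on it. -/
theorem inner_eq_zero_iff_exists_smul_orthVec {α₀ β₀ : ℂ} (h0 : (α₀, β₀) ≠ (0, 0))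
    (u : EuclideanSpace ℂ (Fin 2)) :
    inner ℂ (!₂[α₀, β₀] : EuclideanSpace ℂ (Fin 2)) u = 0 ↔
      u = (inner ℂ (orthVec α₀ β₀) u / (α₀ * conj α₀ + β₀ * conj β₀)) • orthVec α₀ β₀ := by
  have hz : (α₀ * conj α₀ + β₀ * conj β₀ : ℂ) ≠ 0 := by
    rw [Complex.mul_conj', Complex.mul_conj']
    have := sq_norm_add_sq_norm_pos h0
    exact_mod_cast this.ne'
  have hu : u = !₂[u 0, u 1] := by
    ext i
    fin_cases i <;> rfl
  constructor
  · intro h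
    rw [hu, inner_pair] at h
    rw [hu, orthVec, inner_pair]
    ext i
    fin_cases i
    · simp
      field_simp
      linear_combination α₀ * h
    · simp
      field_simp
      linear_combination β₀ * h
  · intro h
    rw [h, inner_smul_right, orthVec, inner_pair]
    ring_nf

/-! ### The Dedieu–Tisseur condition number. -/

/-- The condition operator is the differential of any local branch in the chart. -/
theorem isConditionOperator_iff {n k : ℕ} {B : Coeffs n k} {α₀ β₀ : ℂ} (h0 : (α₀, β₀) ≠ (0, 0))
    {φ : Coeffs n k → ℂ} {L : Coeffs n k →L[ℂ] ℂ} (hφ0 : φ B = 0) (hφ : HasFDerivAt φ L B)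
    (hφe : ∀ᶠ v in 𝓝 (B, (0 : ℂ)), chartDet α₀ β₀ v.1 v.2 = 0 ↔ φ v.1 = v.2)
    (K : Coeffs n k →L[ℂ] EuclideanSpace ℂ (Fin 2)) :
    IsConditionOperator B α₀ β₀ K ↔ K = L.smulRight (orthVec α₀ β₀) := by
  have hbranch : HasFDerivAt (fun A => (!₂[α₀, β₀] : EuclideanSpace ℂ (Fin 2)) +
      φ A • orthVec α₀ β₀) (L.smulRight (orthVec α₀ β₀)) B :=
    (hφ.smul_const (orthVec α₀ β₀)).const_add _
  constructor
  · rintro ⟨S, hSB, hS, hSK⟩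
    -- `ψ A` is the chart coordinate of `S A`. Since `S` is continuous at `B`, `(A, ψ A)` stays near
    -- `(B, 0)`, where the zero set of `chartDet` is the graph of `φ`; hence `ψ = φ` near `B`.
    set ψ : Coeffs n k → ℂ := fun A =>
      inner ℂ (orthVec α₀ β₀) (S A - !₂[α₀, β₀]) / (α₀ * conj α₀ + β₀ * conj β₀) with hψ
    have hcont : Tendsto (fun A => (A, ψ A)) (𝓝 B) (𝓝 (B, (0 : ℂ))) := by
      refine Tendsto.prodMk_nhds tendsto_id ?_
      have h1 : ContinuousAt ψ B :=
        (ContinuousAt.inner (𝕜 := ℂ) continuousAt_const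
          (hSK.continuousAt.sub continuousAt_const)).div_const _
      have h2 : ψ B = 0 := by simp [hψ, hSB]
      rw [← h2]
      exact h1
    have heq : S =ᶠ[𝓝 B] fun A => (!₂[α₀, β₀] : EuclideanSpace ℂ (Fin 2)) +
        φ A • orthVec α₀ β₀ := by
      filter_upwards [hS, hcont.eventually hφe] with A hA hA'
      have h1 := (inner_eq_zero_iff_exists_smul_orthVec h0 _).mp hA.1
      have h2 : S A = !₂[α₀, β₀] + ψ A • orthVec α₀ β₀ := by
        rw [hψ, ← h1]
        abel
      rw [hA'.mp, h2]
      have h3 := hA.2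
      rw [h2] at h3
      rw [chartDet, ← h3]
      simp [orthVec, sub_eq_add_neg]
    exact hSK.unique (hbranch.congr_of_eventuallyEq heq)
  · rintro rfl
    refine ⟨_, by simp [hφ0], ?_, hbranch⟩
    have hcont : Tendsto (fun A => (A, φ A)) (𝓝 B) (𝓝 (B, (0 : ℂ))) := by
      refine Tendsto.prodMk_nhds tendsto_id ?_
      rw [← hφ0]
      exact hφ.continuousAt
    filter_upwards [hcont.eventually hφe] with A hA
    refine ⟨?_, ?_⟩
    · rw [add_sub_cancel_left, inner_smul_right, orthVec, inner_pair]
      ring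
    · have := hA.mpr rfl
      rw [chartDet] at this
      rw [← this]
      simp [orthVec, sub_eq_add_neg]

/-- The upper bound is Cauchy–Schwarz over the index `i`. It is attained because a single matrix `E`
is extremal for `τ` in every slot. -/
theorem isLUB_norm_weighted {n k : ℕ} {ω : Fin (k + 1) → ℝ} (hω : ∀ i, 0 ≤ ω i) {α₀ β₀ : ℂ}
    (h0 : (α₀, β₀) ≠ (0, 0)) {c : Fin (k + 1) → ℂ} (hpos : ∃ i, ω i * ‖c i‖ ≠ 0)
    {L : Coeffs n k →L[ℂ] ℂ} {τ : Matrix (Fin n) (Fin n) ℂ →ₗ[ℂ] ℂ} {R : ℝ}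
    (hL : ∀ H, L H = ∑ i, c i * τ (H i)) (hR : 0 < R) (hτ : ∀ E, ‖τ E‖ ≤ R * specNorm E)
    (hE : ∃ E, ‖E‖ ≤ 1 ∧ τ E = R) :
    IsLUB {q : ℝ | ∃ E : Coeffs n k, ∑ i, ‖E i‖ ^ 2 ≤ 1 ∧
      q = ‖L.smulRight (orthVec α₀ β₀) (fun i => (ω i : ℂ) • E i)‖ /
        ‖(!₂[α₀, β₀] : EuclideanSpace ℂ (Fin 2))‖} (R * √(∑ i, (ω i * ‖c i‖) ^ 2)) := by
  have hz := norm_pair_pos h0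
  have hquot : ∀ E : Coeffs n k, ‖L.smulRight (orthVec α₀ β₀) (fun i => (ω i : ℂ) • E i)‖ /
        ‖(!₂[α₀, β₀] : EuclideanSpace ℂ (Fin 2))‖ = ‖∑ i, c i * ((ω i : ℂ) * τ (E i))‖ := by
    intro E
    rw [ContinuousLinearMap.smulRight_apply, norm_smul, norm_orthVec, mul_div_cancel_right₀ _ hz.ne',
      hL]
    simp only [map_smul, smul_eq_mul]
  have hsum : 0 < ∑ i, (ω i * ‖c i‖) ^ 2 := by
    obtain ⟨i, hi⟩ := hpos
    exact Finset.sum_pos' (fun i _ => sq_nonneg _) ⟨i, Finset.mem_univ i, by positivity⟩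
  set σ := √(∑ i, (ω i * ‖c i‖) ^ 2) with hσ
  have hσpos : 0 < σ := Real.sqrt_pos.mpr hsum
  have hσsq : σ ^ 2 = ∑ i, (ω i * ‖c i‖) ^ 2 := Real.sq_sqrt hsum.le
  constructor
  · rintro _ ⟨E, hE1, rfl⟩
    rw [hquot]
    calc ‖∑ i, c i * ((ω i : ℂ) * τ (E i))‖ ≤ ∑ i, ‖c i * ((ω i : ℂ) * τ (E i))‖ :=
          norm_sum_le _ _
      _ ≤ ∑ i, R * ((ω i * ‖c i‖) * ‖E i‖) := by
          refine Finset.sum_le_sum fun i _ => ?_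
          rw [norm_mul, norm_mul, Complex.norm_of_nonneg (hω i)]
          have h1 : ‖τ (E i)‖ ≤ R * ‖E i‖ :=
            (hτ _).trans (mul_le_mul_of_nonneg_left (specNorm_le_norm _) hR.le)
          have h2 := mul_le_mul_of_nonneg_left h1 (mul_nonneg (hω i) (norm_nonneg (c i)))
          linarith
      _ = R * ∑ i, (ω i * ‖c i‖) * ‖E i‖ := by rw [Finset.mul_sum]
      _ ≤ R * (σ * √(∑ i, ‖E i‖ ^ 2)) := by
          gcongr
          exact Real.sum_mul_le_sqrt_mul_sqrt _ _ _
      _ ≤ R * (σ * 1) := by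
          gcongr
          exact Real.sqrt_le_one.mpr hE1
      _ = R * σ := by rw [mul_one]
  · intro q hq
    apply hq
    obtain ⟨E, hE1, hEτ⟩ := hE
    -- The equality case of Cauchy–Schwarz: moduli proportional to `ω i * ‖c i‖`, phases cancelling
    -- those of `c i`.
    refine ⟨fun i => (conj (c i) * (ω i : ℂ) / (σ : ℂ)) • E, ?_, ?_⟩
    · calc ∑ i, ‖(conj (c i) * (ω i : ℂ) / (σ : ℂ)) • E‖ ^ 2
          ≤ ∑ i, (ω i * ‖c i‖) ^ 2 / σ ^ 2 := by
            refine Finset.sum_le_sum fun i _ => ?_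
            rw [norm_smul, norm_div, norm_mul, Complex.norm_conj, Complex.norm_of_nonneg (hω i),
              Complex.norm_of_nonneg hσpos.le, ← div_pow, mul_comm (ω i)]
            have := hω i
            refine pow_le_pow_left₀ (by positivity) ?_ 2
            exact mul_le_of_le_one_right (by positivity) hE1
        _ = 1 := by rw [← Finset.sum_div, ← hσsq, div_self (by positivity)]
    · rw [hquot]
      have h1 : ∑ i, c i * ((ω i : ℂ) * τ ((conj (c i) * (ω i : ℂ) / (σ : ℂ)) • E)) =
          ((R * σ : ℝ) : ℂ) := by
        have hσ' : (σ : ℂ) ≠ 0 := by exact_mod_cast hσpos.ne'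
        have h2 : ∀ i, c i * ((ω i : ℂ) * τ ((conj (c i) * (ω i : ℂ) / (σ : ℂ)) • E)) =
            ((R / σ * (ω i * ‖c i‖) ^ 2 : ℝ) : ℂ) := by
          intro i
          rw [map_smul, hEτ, smul_eq_mul]
          push_cast
          rw [mul_pow, ← Complex.mul_conj']
          field_simp
        rw [Finset.sum_congr rfl fun i _ => h2 i, ← Complex.ofReal_sum, ← Finset.mul_sum, ← hσsq]
        congr 1
        field_simp
      rw [h1, Complex.norm_of_nonneg (by positivity)]

/-! ### The Stewart–Sun condition number. -/

theorem chordalQuotients_bddAbove {n k : ℕ} (B : Coeffs n k) (ω : Fin (k + 1) → ℝ) (α₀ β₀ : ℂ)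
    (r : ℝ) {ε : ℝ} (hε : 0 < ε) : BddAbove (chordalQuotients B ω α₀ β₀ r ε) := by
  refine ⟨1 / ε, ?_⟩
  rintro _ ⟨-, α, β, -, -, -, -, -, -, rfl⟩
  exact div_le_div_of_nonneg_right (chordalDist_le_one _ _) hε.le

/-- Each slot is bounded separately, so the triangle inequality gives `‖L ΔB‖ ≤ κ ε`, and aligning
the phases of all slots gives equality. The remainder of `φ` and the difference between chordal
distance and `‖t‖` vanish in the limit. -/
theorem isStewartSunCondNumber_of_branch {n k : ℕ} {B : Coeffs n k} {ω : Fin (k + 1) → ℝ}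
    (hω : ∀ i, 0 ≤ ω i) {α₀ β₀ : ℂ} (h0 : (α₀, β₀) ≠ (0, 0)) {c : Fin (k + 1) → ℂ}
    {φ : Coeffs n k → ℂ} {L : Coeffs n k →L[ℂ] ℂ} {τ : Matrix (Fin n) (Fin n) ℂ →ₗ[ℂ] ℂ} {R : ℝ}
    (hφ0 : φ B = 0) (hφ : HasFDerivAt φ L B)
    (hφe : ∀ᶠ v in 𝓝 (B, (0 : ℂ)), chartDet α₀ β₀ v.1 v.2 = 0 ↔ φ v.1 = v.2)
    (hL : ∀ H, L H = ∑ i, c i * τ (H i)) (hR : 0 < R) (hτ : ∀ E, ‖τ E‖ ≤ R * specNorm E)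
    (hE : ∃ E, ‖E‖ ≤ 1 ∧ τ E = R) :
    IsStewartSunCondNumber B ω α₀ β₀ (R * ∑ i, ω i * ‖c i‖) := by
  set κ := R * ∑ i, ω i * ‖c i‖ with hκ
  have hκ0 : 0 ≤ κ :=
    mul_nonneg hR.le (Finset.sum_nonneg fun i _ => mul_nonneg (hω i) (norm_nonneg _))
  -- the local branch, with explicit neighbourhoods
  obtain ⟨δ, hδ, hbranch⟩ : ∃ δ > 0, ∀ (A : Coeffs n k) (t : ℂ), ‖A - B‖ < δ → ‖t‖ < δ →
      (chartDet α₀ β₀ A t = 0 ↔ φ A = t) := by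
    obtain ⟨δ, hδ, h⟩ := Metric.eventually_nhds_iff.mp hφe
    refine ⟨δ, hδ, fun A t hA ht => h (y := (A, t)) ?_⟩
    rw [Prod.dist_eq, max_lt_iff, dist_eq_norm, dist_eq_norm, sub_zero]
    exact ⟨hA, ht⟩
  set C : ℝ := n * ∑ i, ω i with hC
  have hsumω : 0 ≤ ∑ i, ω i := Finset.sum_nonneg fun i _ => hω i
  have hC0 : 0 ≤ C := mul_nonneg (Nat.cast_nonneg n) hsumω
  have hpert : ∀ (ε : ℝ) (ΔB : Coeffs n k), 0 < ε → (∀ i, specNorm (ΔB i) ≤ ε * ω i) →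
      ‖ΔB‖ ≤ C * ε ∧ ‖L ΔB‖ ≤ κ * ε := by
    intro ε ΔB hε hΔ
    constructor
    · refine (pi_norm_le_iff_of_nonneg (by positivity)).mpr fun i => ?_
      calc ‖ΔB i‖ ≤ n * specNorm (ΔB i) := norm_le_mul_specNorm _
        _ ≤ n * (ε * ω i) := by gcongr; exact hΔ i
        _ ≤ n * (ε * ∑ i, ω i) := by
          gcongr
          exact Finset.single_le_sum (fun i _ => hω i) (Finset.mem_univ i)
        _ = C * ε := by rw [hC]; ring
    · rw [hL]
      calc ‖∑ i, c i * τ (ΔB i)‖ ≤ ∑ i, ‖c i * τ (ΔB i)‖ := norm_sum_le _ _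
        _ ≤ ∑ i, R * ε * (ω i * ‖c i‖) := by
          refine Finset.sum_le_sum fun i _ => ?_
          rw [norm_mul]
          have h1 := (hτ (ΔB i)).trans (mul_le_mul_of_nonneg_left (hΔ i) hR.le)
          have h2 := mul_le_mul_of_nonneg_left h1 (norm_nonneg (c i))
          linarith
        _ = κ * ε := by rw [← Finset.mul_sum, hκ]; ring
  -- From `‖t‖ < r √(1 + ‖t‖²) ≤ r (1 + ‖t‖)` and `r < 1/2` follows `‖t‖ < 2r < δ`, so the
  -- eigenvalue lies on the branch.
  have hr0 : (0 : ℝ) < min (1 / 2) (δ / 2) := by positivity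
  filter_upwards [Ioo_mem_nhdsGT hr0] with r hr
  obtain ⟨hrpos, hr1⟩ := hr
  have hr2 : r < 1 / 2 := hr1.trans_le (min_le_left _ _)
  have hr3 : r < δ / 2 := hr1.trans_le (min_le_right _ _)
  -- upper bound for the quotients
  have hupper : ∀ η > 0, ∀ᶠ ε in 𝓝[>] (0 : ℝ),
      ∀ q ∈ chordalQuotients B ω α₀ β₀ r ε, q ≤ κ + η := by
    intro η hη
    -- The linearisation error is then at most `η / (C + 1) * (C * ε) ≤ η * ε`; `C + 1` is used
    -- since `C` may be zero.
    have hη' : 0 < η / (C + 1) := by positivity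
    obtain ⟨δ', hδ', hlin⟩ : ∃ δ' > 0, ∀ A : Coeffs n k, ‖A - B‖ < δ' →
        ‖φ A - φ B - L (A - B)‖ ≤ η / (C + 1) * ‖A - B‖ := by
      obtain ⟨δ', hδ', h⟩ := Metric.eventually_nhds_iff.mp (hφ.isLittleO.def hη')
      exact ⟨δ', hδ', fun A hA => h (by rwa [dist_eq_norm])⟩
    have hε0 : 0 < min δ δ' / (C + 1) := by positivity
    filter_upwards [Ioo_mem_nhdsGT hε0] with ε hε
    rintro _ ⟨ΔB, α, β, v, hΔ, -, hv, hker, hχ, rfl⟩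
    obtain ⟨hΔ1, hΔ2⟩ := hpert ε ΔB hε.1 hΔ
    have hsmall : ‖B + ΔB - B‖ < min δ δ' := by
      rw [add_sub_cancel_left]
      have h1 := (lt_div_iff₀ (by positivity)).mp hε.2
      have h2 := hε.1
      linarith
    obtain ⟨s, t, hs, hα, hβ⟩ := exists_chart_of_chordalDist_lt_one h0 (by linarith)
    rw [hα, hβ] at hχ hker ⊢
    rw [chordalDist_chart h0 hs] at hχ ⊢
    have hsq1 : 1 ≤ √(1 + ‖t‖ ^ 2) := Real.one_le_sqrt.mpr (by nlinarith [norm_nonneg t])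
    have hsq2 : √(1 + ‖t‖ ^ 2) ≤ 1 + ‖t‖ :=
      Real.sqrt_le_iff.mpr ⟨by positivity, by nlinarith [norm_nonneg t]⟩
    have ht : ‖t‖ < δ := by
      have h1 := (div_lt_iff₀ (by positivity)).mp hχ
      nlinarith [norm_nonneg t]
    rw [← homEval_add] at hker
    have hφt : φ (B + ΔB) = t :=
      (hbranch _ _ (hsmall.trans_le (min_le_left _ _)) ht).mp (chartDet_eq_zero_of_mulVec hs hv hker)
    have h1 := hlin _ (hsmall.trans_le (min_le_right _ _))
    rw [hφt, hφ0, sub_zero, add_sub_cancel_left] at h1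
    have h2 : ‖t‖ ≤ (κ + η) * ε := by
      have h3 : ‖t‖ ≤ ‖t - L ΔB‖ + ‖L ΔB‖ := by simpa using norm_add_le (t - L ΔB) (L ΔB)
      have h4 : η / (C + 1) * ‖ΔB‖ ≤ η / (C + 1) * (C * ε) := by gcongr
      have h5 : η / (C + 1) * (C * ε) ≤ η * ε := by
        rw [div_mul_eq_mul_div, div_le_iff₀ (by positivity)]
        have := mul_pos hη hε.1
        nlinarith
      linarith
    rw [div_le_iff₀ hε.1]
    exact (div_le_self (norm_nonneg t) hsq1).trans h2
  -- a perturbation that attains the bound to first order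
  obtain ⟨E, hE1, hEτ⟩ := hE
  set D : Coeffs n k := fun i => (conj (c i) / (‖c i‖ : ℂ) * (ω i : ℂ)) • E with hD
  -- If `c i = 0`, the phase is `0 / 0 = 0` and slot `i` is not perturbed.
  have hphase : ∀ i, c i * (conj (c i) / (‖c i‖ : ℂ)) = ‖c i‖ := by
    intro i
    by_cases hci : c i = 0
    · simp [hci]
    · have : (‖c i‖ : ℂ) ≠ 0 := by simpa using hci
      rw [← mul_div_assoc, Complex.mul_conj']
      field_simp
  have hDspec : ∀ i, specNorm (D i) ≤ ω i := by
    intro i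
    refine (specNorm_le_norm _).trans ?_
    rw [hD]
    simp only [norm_smul, norm_mul, norm_div, Complex.norm_conj, Complex.norm_real, norm_norm,
      Real.norm_of_nonneg (hω i)]
    have h1 : ‖c i‖ / ‖c i‖ ≤ 1 := div_self_le_one _
    have h2 : 0 ≤ ‖c i‖ / ‖c i‖ := by positivity
    have := hω i
    calc ‖c i‖ / ‖c i‖ * ω i * ‖E‖ ≤ 1 * ω i * 1 := by gcongr
      _ = ω i := by ring
  have hLD : L D = κ := by
    rw [hL, hκ]
    push_cast
    rw [Finset.mul_sum]
    refine Finset.sum_congr rfl fun i _ => ?_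
    rw [hD, map_smul, hEτ, smul_eq_mul]
    linear_combination ((ω i : ℂ) * R) * hphase i
  set T : ℝ → ℂ := fun ε => φ (B + (ε : ℂ) • D) with hT
  have hTslope : Tendsto (fun ε : ℝ => ‖T ε‖ / ε) (𝓝[>] 0) (𝓝 κ) := by
    have h1 : HasDerivAt (fun s : ℂ => φ (B + s • D)) (L D) 0 := hφ.hasLineDerivAt D
    rw [hLD, hasDerivAt_iff_tendsto_slope] at h1
    have h2 : Tendsto (fun ε : ℝ => (ε : ℂ)) (𝓝[>] 0) (𝓝[≠] 0) := by
      refine tendsto_nhdsWithin_iff.mpr ⟨?_, ?_⟩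
      · exact (Complex.continuous_ofReal.tendsto' 0 0 (by simp)).mono_left nhdsWithin_le_nhds
      · filter_upwards [self_mem_nhdsWithin] with ε hε
        have : ε ≠ 0 := ne_of_gt hε
        simpa using this
    have h3 := (h1.comp h2).norm
    rw [Complex.norm_of_nonneg hκ0] at h3
    refine h3.congr' ?_
    filter_upwards [self_mem_nhdsWithin] with ε hε
    have hε : 0 < ε := hε
    simp [slope_def_field, hφ0, hT, abs_of_pos hε]
  have hTzero : Tendsto (fun ε : ℝ => ‖T ε‖) (𝓝[>] 0) (𝓝 0) := by
    have hid : Tendsto (fun ε : ℝ => ε) (𝓝[>] 0) (𝓝 0) := tendsto_id.mono_left nhdsWithin_le_nhds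
    have h1 := hTslope.mul hid
    rw [mul_zero] at h1
    refine h1.congr' ?_
    filter_upwards [self_mem_nhdsWithin] with ε hε
    exact div_mul_cancel₀ _ (ne_of_gt hε)
  have hlim : Tendsto (fun ε : ℝ => ‖T ε‖ / √(1 + ‖T ε‖ ^ 2) / ε) (𝓝[>] 0) (𝓝 κ) := by
    have h1 : Tendsto (fun ε : ℝ => √(1 + ‖T ε‖ ^ 2)) (𝓝[>] 0) (𝓝 1) := by
      have : Continuous fun x : ℝ => √(1 + x ^ 2) := by fun_prop
      exact (this.tendsto' 0 1 (by simp)).comp hTzero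
    have h2 := hTslope.div h1 one_ne_zero
    rw [div_one] at h2
    refine h2.congr fun ε => ?_
    simp only [Pi.div_apply]
    rw [div_right_comm]
  have hmem : ∀ᶠ ε in 𝓝[>] (0 : ℝ),
      ‖T ε‖ / √(1 + ‖T ε‖ ^ 2) / ε ∈ chordalQuotients B ω α₀ β₀ r ε := by
    have hε0 : 0 < δ / (C + 1) := by positivity
    filter_upwards [Ioo_mem_nhdsGT hε0, hTzero.eventually_lt_const hrpos] with ε hε hTr
    have hΔ : ∀ i, specNorm (((ε : ℂ) • D) i) ≤ ε * ω i := by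
      intro i
      have h1 : specNorm (((ε : ℂ) • D) i) = ε * specNorm (D i) := by
        rw [Pi.smul_apply, specNorm, map_smul, norm_smul, Complex.norm_of_nonneg hε.1.le, specNorm]
      rw [h1]
      exact mul_le_mul_of_nonneg_left (hDspec i) hε.1.le
    have hsmall : ‖B + (ε : ℂ) • D - B‖ < δ := by
      rw [add_sub_cancel_left]
      have h1 := (lt_div_iff₀ (by positivity)).mp hε.2
      have h2 := hε.1
      have h3 := (hpert ε _ hε.1 hΔ).1
      linarith
    have hdet : chartDet α₀ β₀ (B + (ε : ℂ) • D) (T ε) = 0 :=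
      (hbranch _ _ hsmall (by linarith)).mpr rfl
    obtain ⟨v, hv, hker⟩ := Matrix.exists_mulVec_eq_zero_iff.mpr hdet
    have hχ := chordalDist_chart h0 one_ne_zero (T ε)
    rw [one_mul, one_mul] at hχ
    have hsq1 : 1 ≤ √(1 + ‖T ε‖ ^ 2) := Real.one_le_sqrt.mpr (by nlinarith [norm_nonneg (T ε)])
    refine ⟨(ε : ℂ) • D, α₀ - T ε * conj β₀, β₀ + T ε * conj α₀, v, hΔ, ?_, hv, ?_, ?_, ?_⟩
    · intro h
      have hz := sq_norm_add_sq_norm_pos h0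
      have h1 := (Prod.mk.injEq _ _ _ _).mp h
      have h2 : (α₀ - T ε * conj β₀) * conj α₀ + (β₀ + T ε * conj α₀) * conj β₀ = 0 := by
        rw [h1.1, h1.2]
        ring
      have h3 : α₀ * conj α₀ + β₀ * conj β₀ = 0 := by linear_combination h2
      rw [Complex.mul_conj', Complex.mul_conj'] at h3
      have h4 : ‖α₀‖ ^ 2 + ‖β₀‖ ^ 2 = 0 := by exact_mod_cast h3
      linarith
    · rw [← homEval_add]
      exact hker
    · rw [hχ]
      exact (div_le_self (norm_nonneg _) hsq1).trans_lt hTr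
    · rw [hχ]
  -- The attaining perturbation bounds the supremum from below and also supplies the nonemptiness
  -- needed for the upper bound.
  refine tendsto_order.mpr ⟨fun a ha => ?_, fun a ha => ?_⟩
  · filter_upwards [hmem, hlim.eventually_const_lt ha, self_mem_nhdsWithin] with ε h1 h2 h3
    exact h2.trans_le (le_csSup (chordalQuotients_bddAbove B ω α₀ β₀ r h3) h1)
  · filter_upwards [hmem, hupper ((a - κ) / 2) (by linarith)] with ε h1 h2
    have := csSup_le ⟨_, h1⟩ h2
    linarith

theorem IsStewartSunCondNumber.unique {n k : ℕ} {B : Coeffs n k} {ω : Fin (k + 1) → ℝ} {α₀ β₀ : ℂ}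
    {κ κ' : ℝ} (h : IsStewartSunCondNumber B ω α₀ β₀ κ)
    (h' : IsStewartSunCondNumber B ω α₀ β₀ κ') : κ = κ' := by
  obtain ⟨r, hr, hr'⟩ := (h.and h').exists
  exact tendsto_nhds_unique hr hr'

end HomogeneousPEP

/-! ### Comparison of the two condition numbers. -/

open HomogeneousPEP in
/-- For a simple eigenvalue, both homogeneous condition numbers (for the same weights) exist, are
uniquely determined, and satisfy the two bounds. The hypothesis `hpos` says that `κθ` is not zero,
so that the quotient makes sense. -/
theorem corollary3p3 {n k : ℕ} (B : Coeffs n k) (ω : Fin (k + 1) → ℝ) (hω : ∀ i, 0 ≤ ω i)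
    (α₀ β₀ : ℂ) (hsimple : IsSimpleEigenvalue B α₀ β₀)
    (hpos : ∃ i : Fin (k + 1), ω i * ‖α₀‖ ^ (i : ℕ) * ‖β₀‖ ^ (k - (i : ℕ)) ≠ 0) :
    ∃ κh κθ : ℝ,
      (∀ κ : ℝ, IsDedieuTisseurCondNumber B ω α₀ β₀ κ ↔ κ = κh) ∧
      (∀ κ : ℝ, IsStewartSunCondNumber B ω α₀ β₀ κ ↔ κ = κθ) ∧
      0 < κθ ∧
      1 / Real.sqrt ((k : ℝ) + 1) ≤ κh / κθ ∧ κh / κθ ≤ 1 := by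
  have h0 := hsimple.1
  obtain ⟨φ, L, τ, R, hφ0, hφ, hφe, hL, hR, hτ, hE⟩ := hsimple.exists_branch
  set c : Fin (k + 1) → ℂ := fun i => α₀ ^ (i : ℕ) * β₀ ^ (k - (i : ℕ)) with hc
  have hpos' : ∃ i, ω i * ‖c i‖ ≠ 0 := by
    obtain ⟨i, hi⟩ := hpos
    exact ⟨i, by rwa [hc, norm_mul, norm_pow, norm_pow, ← mul_assoc]⟩
  have hnn : ∀ i, 0 ≤ ω i * ‖c i‖ := fun i => mul_nonneg (hω i) (norm_nonneg _)
  have hsum : 0 < ∑ i, ω i * ‖c i‖ := by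
    obtain ⟨i, hi⟩ := hpos'
    exact Finset.sum_pos' (fun i _ => hnn i) ⟨i, Finset.mem_univ i, (hnn i).lt_of_ne' hi⟩
  have hθ := isStewartSunCondNumber_of_branch hω h0 hφ0 hφ hφe hL hR hτ hE
  have hh := isLUB_norm_weighted hω h0 hpos' hL hR hτ hE
  refine ⟨R * √(∑ i, (ω i * ‖c i‖) ^ 2), R * ∑ i, ω i * ‖c i‖, fun κ => ⟨?_, ?_⟩,
    fun κ => ⟨fun h => h.unique hθ, fun h => h ▸ hθ⟩, mul_pos hR hsum, ?_, ?_⟩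
  · rintro ⟨K, hK, hlub⟩
    obtain rfl := (isConditionOperator_iff h0 hφ0 hφ hφe K).mp hK
    exact hlub.unique hh
  · rintro rfl
    exact ⟨_, (isConditionOperator_iff h0 hφ0 hφ hφe _).mpr rfl, hh⟩
  -- After `R` cancels, this is `(∑ a i)² ≤ (k + 1) ∑ a i ^ 2` for `a i = ω i * ‖c i‖`.
  · rw [mul_div_mul_left _ _ hR.ne', div_le_div_iff₀ (by positivity) hsum, one_mul,
      ← Real.sqrt_mul (Finset.sum_nonneg fun i _ => sq_nonneg _)]
    refine Real.le_sqrt_of_sq_le ?_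
    have := sq_sum_le_card_mul_sum_sq (s := Finset.univ) (f := fun i => ω i * ‖c i‖)
    rw [Finset.card_univ, Fintype.card_fin] at this
    push_cast at this
    linarith
  · rw [mul_div_mul_left _ _ hR.ne', div_le_one hsum]
    exact Real.sqrt_le_iff.mpr ⟨hsum.le, Finset.sum_sq_le_sq_sum_of_nonneg fun i _ => hnn i⟩
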